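/- Let $T\ge 1$ and let $y(t)\ge 0$, $p_0(t)>0$, $p(t)=(p_1(t),p_2(t))$ with $p_1(t),p_2(t)>0$ $(t=1,\dots,T)$ be given time series, and let $\rho\in[-1,0)\cup(0,+\infty)$. We say that $\rho$ is a solution of the elasticity estimation problem if there is a non-negative absolutely continuous measure $\mu$ on $\mathbb R^2_+$ such that $$\int_{\mathbb R^2_+}\theta\Bigl(p_0(t)-\bigl(p_1(t)^{-\rho}x_1^{-\rho}+p_2(t)^{-\rho}x_2^{-\rho}\bigr)^{-1/\rho}\Bigr)\,\mu(dx)=y(t)\qquad(t=1,\dots,T),$$ where $\theta(s)=1$ for $s\ge 0$ and $\theta(s)=0$ for $s<0$. Put $\widehat p_i(t)=p_i(t)/p_0(t)$. If $\rho<0$, put $\widetilde p_i(t,\rho)=\widehat p_i(t)^{-\rho}$; if $\rho>0$, put $\widetilde p_i(t,\rho)=\frac1\varepsilon-\widehat p_i(t)^{-\rho}$, where $\varepsilon>0$ is such that $\widehat p_i(t)^{-\rho}<\frac1\varepsilon$ for $i=1,2$ and all $t$, and $\bigl(\widehat p_1(t)^{-\rho}x_1^{-\rho}+\widehat p_2(t)^{-\rho}x_2^{-\rho}\bigr)^{-1/\rho}>1$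 for all $t$ whenever $x_1,x_2>0$ and $x_1^{-\rho}+x_2^{-\rho}\le\varepsilon$. Suppose that the times are numbered so that $\widetilde p_1(1,\rho)<\dots<\widetilde p_1(T,\rho)$, let $\Sigma_\rho\in S_T$ be the permutation with $\widetilde p_2(\Sigma_\rho(1),\rho)<\dots<\widetilde p_2(\Sigma_\rho(T),\rho)$, and let $\lambda\in S_T$ be the permutation with $y(\lambda(T))<\dots<y(\lambda(1))$ (all these orderings are assumed to be strict). Let $\xi_j=(j-\lfloor T/2\rfloor,1)\in\mathbb R^2$, $j=1,\dots,T$. For $\alpha\in S_T$, the snake $Sn(\alpha)$ is the polygonal chain with the consecutive vertices $V_1(\alpha),\dots,V_{T+1}(\alpha)$, where $V_k(\alpha)=\xi_{\alpha(k)}+\xi_{\alpha(k+1)}+\dots+\xi_{\alpha(T)}$ for $k\le T$ and $V_{T+1}(\alpha)=0$. The closed bounded region bounded by $Sn(\mathrm{id})$ and $Sn(\Sigma_\rho)$ consists of these two chains and of the bounded connected components of the complement of their union in $\mathbb R^2$. If $Sn(\lambda)$ is not contained in the closed bounded region bounded by $Sn(\mathrm{id})$ and $Sn(\Sigma_\rho)$,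 then $\rho$ is not a solution of the elasticity estimation problem. -/

import Mathlib

open MeasureTheory

namespace Elasticity

noncomputable section

/-- The Heaviside function, with value `1` at `0`. -/
def theta (s : ℝ) : ℝ := if 0 ≤ s then 1 else 0

/-- The CES unit cost `h(p ∘ x) = (p₁^{-ρ} x₁^{-ρ} + p₂^{-ρ} x₂^{-ρ})^{-1/ρ}`. -/
def cesCost (ρ : ℝ) (p x : ℝ × ℝ) : ℝ :=
  (p.1 ^ (-ρ) * x.1 ^ (-ρ) + p.2 ^ (-ρ) * x.2 ^ (-ρ)) ^ (-1 / ρ)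

/-- The open positive quadrant. The boundary of the closed quadrant is a Lebesgue null set, so it
plays no role for absolutely continuous measures. -/
def quadrant : Set (ℝ × ℝ) := {x | 0 < x.1 ∧ 0 < x.2}

/-- Solvability of the moment problem in the class of non-negative absolutely continuous
measures: `∫ θ(p₀(t) - h(p(t) ∘ x)) μ(dx) = y(t)` for all `t`, with a convergent integral. -/
def MomentProblemSolvable {T : ℕ} (y p₀ : Fin T → ℝ) (p : Fin T → ℝ × ℝ) (ρ : ℝ) : Prop :=
  ∃ μ : Measure (ℝ × ℝ), μ ≪ volume ∧
    ∀ t, IntegrableOn (fun x => theta (p₀ t - cesCost ρ (p t) x)) quadrant μ ∧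
      ∫ x in quadrant, theta (p₀ t - cesCost ρ (p t) x) ∂μ = y t

/-- `ρ` is a solution of the elasticity estimation problem. -/
def IsElasticitySolution {T : ℕ} (y p₀ : Fin T → ℝ) (p : Fin T → ℝ × ℝ) (ρ : ℝ) : Prop :=
  ρ ∈ Set.Ico (-1 : ℝ) 0 ∪ Set.Ioi 0 ∧ MomentProblemSolvable y p₀ p ρ

/-- Relative prices `p̂(t) = p(t) / p₀(t)`. -/
def phat {T : ℕ} (p₀ : Fin T → ℝ) (p : Fin T → ℝ × ℝ) (t : Fin T) : ℝ × ℝ :=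
  ((p t).1 / p₀ t, (p t).2 / p₀ t)

/-- The requirement on the constant `ε` of the change of variables used for `ρ > 0`. For `ρ < 0`
the constant is not used and only `ε > 0` is asked. -/
def AdmissibleEps {T : ℕ} (p₀ : Fin T → ℝ) (p : Fin T → ℝ × ℝ) (ρ ε : ℝ) : Prop :=
  0 < ε ∧ (0 < ρ → ∀ t,
    (∀ x ∈ quadrant, x.1 ^ (-ρ) + x.2 ^ (-ρ) ≤ ε → 1 < cesCost ρ (phat p₀ p t) x) ∧
    (phat p₀ p t).1 ^ (-ρ) < 1 / ε ∧ (phat p₀ p t).2 ^ (-ρ) < 1 / ε)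

/-- The transformed prices `p̃(t, ρ)`: `p̂ᵢ(t)^{-ρ}` if `ρ < 0`, and `1/ε - p̂ᵢ(t)^{-ρ}` if
`ρ > 0`. -/
def ptilde {T : ℕ} (p₀ : Fin T → ℝ) (p : Fin T → ℝ × ℝ) (ρ ε : ℝ) (t : Fin T) : ℝ × ℝ :=
  if ρ < 0 then ((phat p₀ p t).1 ^ (-ρ), (phat p₀ p t).2 ^ (-ρ))
  else (1 / ε - (phat p₀ p t).1 ^ (-ρ), 1 / ε - (phat p₀ p t).2 ^ (-ρ))

/-- The vectors `ξ_j = (j - ⌊T/2⌋, 1)`, `j = 1, …, T`. The element `j` of `Fin T` stands for the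
index `j + 1`. -/
def xi {T : ℕ} (j : Fin T) : ℝ × ℝ := ((j.val : ℝ) + 1 - ((T / 2 : ℕ) : ℝ), 1)

/-- The vertex `V_{k+1}(a) = ξ_{a(k+1)} + ⋯ + ξ_{a(T)}` of the snake (indices shifted by one), for
`k = 0, …, T`; it is `0` for `k = T`. -/
def snakeVertex {T : ℕ} (a : Equiv.Perm (Fin T)) (k : ℕ) : ℝ × ℝ :=
  ∑ i ∈ Finset.univ.filter (fun i : Fin T => k ≤ i.val), xi (a i)

/-- The snake `Sn(a)`: the polygonal chain through `V_1(a), …, V_{T+1}(a)`. -/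
def snake {T : ℕ} (a : Equiv.Perm (Fin T)) : Set (ℝ × ℝ) :=
  ⋃ k : Fin T, segment ℝ (snakeVertex a k) (snakeVertex a (k + 1))

/-- The closed bounded region bounded by two curves `A` and `B` in the plane: the curves themselves
together with the bounded connected components of the complement of their union. -/
def regionBoundedBy (A B : Set (ℝ × ℝ)) : Set (ℝ × ℝ) :=
  A ∪ B ∪ {z | z ∉ A ∪ B ∧ Bornology.IsBounded (connectedComponentIn (A ∪ B)ᶜ z)}

end

end Elasticity

/-!
The proof rests on one economic observation: a time moment at which both relative prices are lower
is one at which every technology that is profitable at the dearer moment is still profitable. So if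
`i < j` and `i` stands before `j` in the ordering `Σ_ρ` as well (both relative prices increase from
`i` to `j`), then every solution of the moment problem has `y j ≤ y i`
(`le_of_phat_le`), and `i` stands before `j` in `λ`. Hence the inversions of `λ` are among those of
`Σ_ρ`: `λ` lies between the identity and `Σ_ρ` in the weak Bruhat order.

Consequently, for each `k`, the sum of the last `k` values of `λ` is at least that of `Σ_ρ`
(`sum_final_le`): writing `L`, `S` for the two sets of last values, every element of `S \ L` is
smaller than every element of `L \ S`, since otherwise the pair would be in order in `Σ_ρ` and
inverted in `λ`. The same comparison holds between the identity and any permutation. As the vertices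
of the snakes are sums over final positions, `Sn(λ)` lies horizontally between `Sn(Σ_ρ)` (on the
left) and `Sn(id)` (on the right).

A snake is the graph of a continuous function of the height `s ∈ [0, T]` (`snakePoint`). The
set of points strictly between two such graphs with common ends is relatively clopen in the
complement of the graphs and bounded, so it consists of bounded components
(`mem_regionBoundedBy_of_between`). Thus solvability forces `Sn(λ)` into the region.
-/

namespace Elasticity

open Set

/-! ### Monotonicity of the moments in the prices -/

lemma cesCost_mono {ρ : ℝ} (hρ : ρ ≠ 0) {p q x : ℝ × ℝ} (hp : 0 < p.1 ∧ 0 < p.2)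
    (h1 : p.1 ≤ q.1) (h2 : p.2 ≤ q.2) (hx : x ∈ quadrant) :
    cesCost ρ p x ≤ cesCost ρ q x := by
  obtain ⟨hp1, hp2⟩ := hp
  have hx1 := Real.rpow_pos_of_pos hx.1 (-ρ)
  have hx2 := Real.rpow_pos_of_pos hx.2 (-ρ)
  have hpp1 := Real.rpow_pos_of_pos hp1 (-ρ)
  have hpp2 := Real.rpow_pos_of_pos hp2 (-ρ)
  have hq1 := Real.rpow_pos_of_pos (hp1.trans_le h1) (-ρ)
  have hq2 := Real.rpow_pos_of_pos (hp2.trans_le h2) (-ρ)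
  unfold cesCost
  rcases lt_or_gt_of_ne hρ with h | h
  · have e1 := Real.rpow_le_rpow hp1.le h1 (by linarith : 0 ≤ -ρ)
    have e2 := Real.rpow_le_rpow hp2.le h2 (by linarith : 0 ≤ -ρ)
    exact Real.rpow_le_rpow (by positivity) (by gcongr)
      (div_nonneg_of_nonpos (by norm_num) h.le)
  · have e1 := Real.rpow_le_rpow_of_nonpos hp1 h1 (by linarith : -ρ ≤ 0)
    have e2 := Real.rpow_le_rpow_of_nonpos hp2 h2 (by linarith : -ρ ≤ 0)
    exact Real.rpow_le_rpow_of_nonpos (by positivity) (by gcongr)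
      (div_nonpos_of_nonpos_of_nonneg (by norm_num) h.le)

/-- The unit cost is homogeneous of degree one in the prices. -/
lemma cesCost_phat {T : ℕ} {ρ : ℝ} (hρ : ρ ≠ 0) {p₀ : Fin T → ℝ} {p : Fin T → ℝ × ℝ}
    {t : Fin T} (hp₀ : 0 < p₀ t) (hp : 0 < (p t).1 ∧ 0 < (p t).2) {x : ℝ × ℝ}
    (hx : x ∈ quadrant) : cesCost ρ (phat p₀ p t) x = cesCost ρ (p t) x / p₀ t := by
  have hx1 := Real.rpow_pos_of_pos hx.1 (-ρ)
  have hx2 := Real.rpow_pos_of_pos hx.2 (-ρ)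
  have hp1 := Real.rpow_pos_of_pos hp.1 (-ρ)
  have hp2 := Real.rpow_pos_of_pos hp.2 (-ρ)
  have h0 := Real.rpow_pos_of_pos hp₀ (-ρ)
  have key : (p₀ t ^ (-ρ)) ^ (-1 / ρ) = p₀ t := by
    rw [← Real.rpow_mul hp₀.le, show -ρ * (-1 / ρ) = 1 by field_simp, Real.rpow_one]
  simp only [cesCost, phat]
  rw [Real.div_rpow hp.1.le hp₀.le, Real.div_rpow hp.2.le hp₀.le, div_mul_eq_mul_div,
    div_mul_eq_mul_div, ← add_div, Real.div_rpow (by positivity) h0.le, key]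

/-- The order of the transformed prices is the order of the relative prices, for either sign
of `ρ`. -/
lemma phat_le_of_ptilde_le {T : ℕ} {ρ ε : ℝ} (hρ : ρ ≠ 0) {p₀ : Fin T → ℝ}
    {p : Fin T → ℝ × ℝ} (hp₀ : ∀ t, 0 < p₀ t) (hp : ∀ t, 0 < (p t).1 ∧ 0 < (p t).2)
    {i j : Fin T} (h1 : (ptilde p₀ p ρ ε i).1 ≤ (ptilde p₀ p ρ ε j).1)
    (h2 : (ptilde p₀ p ρ ε i).2 ≤ (ptilde p₀ p ρ ε j).2) :
    (phat p₀ p i).1 ≤ (phat p₀ p j).1 ∧ (phat p₀ p i).2 ≤ (phat p₀ p j).2 := by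
  have hpos : ∀ t, 0 < (phat p₀ p t).1 ∧ 0 < (phat p₀ p t).2 := fun t =>
    ⟨div_pos (hp t).1 (hp₀ t), div_pos (hp t).2 (hp₀ t)⟩
  unfold ptilde at h1 h2
  rcases lt_or_gt_of_ne hρ with h | h
  · simp only [if_pos h] at h1 h2
    have hr : 0 < -ρ := by linarith
    exact ⟨(Real.rpow_le_rpow_iff (hpos i).1.le (hpos j).1.le hr).1 h1,
      (Real.rpow_le_rpow_iff (hpos i).2.le (hpos j).2.le hr).1 h2⟩
  · simp only [if_neg h.not_gt] at h1 h2
    have hr : -ρ < 0 := by linarith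
    exact ⟨(Real.rpow_le_rpow_iff_of_neg (hpos j).1 (hpos i).1 hr).1 (by linarith),
      (Real.rpow_le_rpow_iff_of_neg (hpos j).2 (hpos i).2 hr).1 (by linarith)⟩

/-- Lower relative prices make more technologies profitable, so the moment is larger. -/
lemma le_of_phat_le {T : ℕ} {ρ : ℝ} (hρ : ρ ≠ 0) {y p₀ : Fin T → ℝ}
    {p : Fin T → ℝ × ℝ} (hp₀ : ∀ t, 0 < p₀ t) (hp : ∀ t, 0 < (p t).1 ∧ 0 < (p t).2)
    (hsol : MomentProblemSolvable y p₀ p ρ) {i j : Fin T}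
    (h1 : (phat p₀ p i).1 ≤ (phat p₀ p j).1) (h2 : (phat p₀ p i).2 ≤ (phat p₀ p j).2) :
    y j ≤ y i := by
  obtain ⟨μ, -, hμ⟩ := hsol
  have hq : MeasurableSet quadrant :=
    (measurableSet_lt measurable_const measurable_fst).inter
      (measurableSet_lt measurable_const measurable_snd)
  rw [← (hμ i).2, ← (hμ j).2]
  refine setIntegral_mono_on (hμ j).1 (hμ i).1 hq fun x hx => ?_
  have hle := cesCost_mono hρ
    (p := phat p₀ p i) ⟨div_pos (hp i).1 (hp₀ i), div_pos (hp i).2 (hp₀ i)⟩ h1 h2 hx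
  rw [cesCost_phat hρ (hp₀ i) (hp i) hx, cesCost_phat hρ (hp₀ j) (hp j) hx] at hle
  unfold theta
  split_ifs with hj hi hi
  · exact le_rfl
  · have : cesCost ρ (p j) x / p₀ j ≤ 1 := (div_le_one (hp₀ j)).2 (by linarith)
    have := (div_le_one (hp₀ i)).1 (hle.trans this)
    exact absurd (by linarith) hi
  · exact zero_le_one
  · exact le_rfl

/-! ### Sums over final positions and the weak order -/

lemma sum_le_sum_of_forall_le_of_card_eq {ι : Type*} {A B : Finset ι} {f : ι → ℝ}
    (hcard : A.card = B.card) (h : ∀ a ∈ A, ∀ b ∈ B, f a ≤ f b) :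
    ∑ a ∈ A, f a ≤ ∑ b ∈ B, f b := by
  rcases A.eq_empty_or_nonempty with rfl | hA
  · rw [Finset.card_empty] at hcard
    rw [Finset.card_eq_zero.1 hcard.symm]
  · obtain ⟨m, hm, hmax⟩ := A.exists_max_image f hA
    calc ∑ a ∈ A, f a ≤ A.card • f m := Finset.sum_le_card_nsmul _ _ _ hmax
      _ = B.card • f m := by rw [hcard]
      _ ≤ ∑ b ∈ B, f b := Finset.card_nsmul_le_sum _ _ _ fun b hb => h m hm b hb

/-- If every pair that `b` keeps in order is kept in order by `a` (the weak order), then the sums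
of values over final positions are larger for `a`. -/
lemma sum_final_le {T : ℕ} (a b : Equiv.Perm (Fin T))
    (h : ∀ i j, i < j → b.symm i < b.symm j → a.symm i < a.symm j) (k : ℕ) :
    ∑ i ∈ Finset.univ.filter (fun i : Fin T => k ≤ i.val), ((b i).val : ℝ) ≤
      ∑ i ∈ Finset.univ.filter (fun i : Fin T => k ≤ i.val), ((a i).val : ℝ) := by
  set P := Finset.univ.filter (fun i : Fin T => k ≤ i.val) with hP
  have hmem : ∀ (c : Equiv.Perm (Fin T)) (j : Fin T),
      j ∈ P.map c.toEmbedding ↔ k ≤ (c.symm j).val := fun c j => by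
    rw [Finset.mem_map_equiv, hP, Finset.mem_filter]
    simp
  have hsum : ∀ c : Equiv.Perm (Fin T), ∑ i ∈ P, ((c i).val : ℝ) =
      ∑ j ∈ P.map c.toEmbedding, (j.val : ℝ) := fun c => by
    rw [Finset.sum_map]; rfl
  rw [hsum, hsum, ← sub_nonneg, ← Finset.sum_sdiff_sub_sum_sdiff, sub_nonneg]
  refine sum_le_sum_of_forall_le_of_card_eq
    (Finset.card_sdiff_comm (by rw [Finset.card_map, Finset.card_map])) fun i hi j hj => ?_
  rw [Finset.mem_sdiff, hmem, hmem] at hi hj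
  -- `i` is late in `b` and early in `a`, while `j` is early in `b` and late in `a`
  by_contra hij
  have hij' : j < i := by
    rw [Fin.lt_def]
    exact_mod_cast not_le.1 hij
  have := h j i hij' (Fin.lt_def.2 (by omega))
  rw [Fin.lt_def] at this
  omega

lemma snakeVertex_fst_le {T : ℕ} (a b : Equiv.Perm (Fin T))
    (h : ∀ i j, i < j → b.symm i < b.symm j → a.symm i < a.symm j) (k : ℕ) :
    (snakeVertex b k).1 ≤ (snakeVertex a k).1 := by
  have key : ∀ c : Equiv.Perm (Fin T), (snakeVertex c k).1 =
      ∑ i ∈ Finset.univ.filter (fun i : Fin T => k ≤ i.val), ((c i).val : ℝ) +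
      ∑ i ∈ Finset.univ.filter (fun i : Fin T => k ≤ i.val), (1 - ((T / 2 : ℕ) : ℝ)) := fun c => by
    rw [snakeVertex, Prod.fst_sum, ← Finset.sum_add_distrib]
    exact Finset.sum_congr rfl fun i _ => by simp only [xi]; ring
  rw [key, key]
  exact add_le_add_left (sum_final_le a b h k) _

/-! ### Snakes as graphs over the height -/

/-- The function equal to `0` on `(-∞, 0]`, to the identity on `[0, 1]` and to `1` on
`[1, ∞)`. -/
noncomputable def clamp (u : ℝ) : ℝ := max 0 (min 1 u)

lemma clamp_of_nonpos {u : ℝ} (h : u ≤ 0) : clamp u = 0 :=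
  max_eq_left ((min_le_right _ _).trans h)

lemma clamp_of_one_le {u : ℝ} (h : 1 ≤ u) : clamp u = 1 := by
  rw [clamp, min_eq_left h, max_eq_right zero_le_one]

lemma clamp_of_mem {u : ℝ} (h0 : 0 ≤ u) (h1 : u ≤ 1) : clamp u = u := by
  rw [clamp, min_eq_right h1, max_eq_right h0]

/-- The point of the snake of `a` at height `s ∈ [0, T]`. The vector at the (zero-based) position
`i` enters the partial sums of the snake between the heights `T - 1 - i` and `T - i`. -/
noncomputable def snakePoint {T : ℕ} (a : Equiv.Perm (Fin T)) (s : ℝ) : ℝ × ℝ :=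
  ∑ i : Fin T, clamp (s - (T - 1 - i.val)) • xi (a i)

lemma continuous_snakePoint {T : ℕ} (a : Equiv.Perm (Fin T)) : Continuous (snakePoint a) := by
  unfold snakePoint clamp
  fun_prop

lemma snakePoint_add {T : ℕ} (a : Equiv.Perm (Fin T)) (k : Fin T) {u : ℝ} (h0 : 0 ≤ u)
    (h1 : u ≤ 1) :
    snakePoint a (T - 1 - k.val + u) =
      u • snakeVertex a k + (1 - u) • snakeVertex a (k + 1) := by
  unfold snakePoint snakeVertex
  rw [Finset.sum_filter, Finset.sum_filter, Finset.smul_sum, Finset.smul_sum,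
    ← Finset.sum_add_distrib]
  refine Finset.sum_congr rfl fun i _ => ?_
  rcases lt_trichotomy i.val k.val with h | h | h
  · have hc : (i.val : ℝ) + 1 ≤ k.val := by exact_mod_cast h
    rw [clamp_of_nonpos (by linarith), if_neg (by omega), if_neg (by omega)]
    simp
  · rw [h, if_pos le_rfl, if_neg (by omega), clamp_of_mem (by linarith) (by linarith)]
    simp
  · have hc : (k.val : ℝ) + 1 ≤ i.val := by exact_mod_cast h
    rw [clamp_of_one_le (by linarith), if_pos h.le, if_pos (by omega), ← add_smul]
    simp

lemma snakeVertex_snd {T : ℕ} (a : Equiv.Perm (Fin T)) {k : ℕ} (hk : k ≤ T) :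
    (snakeVertex a k).2 = T - k := by
  have hcard : (Finset.univ.filter (fun i : Fin T => k ≤ i.val)).card = T - k := by
    rw [← Finset.card_map Fin.valEmbedding, ← Nat.card_Ico k T]
    congr 1
    ext j
    simp only [Finset.mem_map, Finset.mem_filter, Finset.mem_univ, true_and, Finset.mem_Ico]
    exact ⟨by rintro ⟨i, hi, rfl⟩; exact ⟨hi, i.isLt⟩, fun h => ⟨⟨j, h.2⟩, h.1, rfl⟩⟩
  rw [snakeVertex, Prod.snd_sum]
  simp [xi, hcard, Nat.cast_sub hk]

lemma snakePoint_add_snd {T : ℕ} (a : Equiv.Perm (Fin T)) (k : Fin T) {u : ℝ} (h0 : 0 ≤ u)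
    (h1 : u ≤ 1) : (snakePoint a (T - 1 - k.val + u)).2 = T - 1 - k.val + u := by
  rw [snakePoint_add a k h0 h1, Prod.snd_add, Prod.smul_snd, Prod.smul_snd,
    snakeVertex_snd a k.isLt.le, snakeVertex_snd a k.isLt, smul_eq_mul, smul_eq_mul]
  push_cast
  ring

lemma mem_snake_iff {T : ℕ} (a : Equiv.Perm (Fin T)) (z : ℝ × ℝ) :
    z ∈ snake a ↔ ∃ k : Fin T, ∃ u : ℝ, 0 ≤ u ∧ u ≤ 1 ∧ snakePoint a (T - 1 - k.val + u) = z := by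
  simp only [snake, mem_iUnion]
  refine exists_congr fun k => ⟨?_, ?_⟩
  · rintro ⟨u, v, hu, hv, huv, rfl⟩
    exact ⟨u, hu, by linarith, by
      rw [snakePoint_add a k hu (by linarith), ← huv, add_sub_cancel_left]⟩
  · rintro ⟨u, h0, h1, rfl⟩
    exact ⟨u, 1 - u, h0, by linarith, by ring, (snakePoint_add a k h0 h1).symm⟩

lemma exists_eq_add_of_mem_Icc {T : ℕ} (hT : 0 < T) {s : ℝ} (hs : s ∈ Icc (0 : ℝ) T) :
    ∃ k : Fin T, ∃ u : ℝ, 0 ≤ u ∧ u ≤ 1 ∧ (T : ℝ) - 1 - k.val + u = s := by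
  rcases hs.2.lt_or_eq with h | h
  · have hm : ⌊s⌋₊ < T := (Nat.floor_lt hs.1).2 h
    refine ⟨⟨T - 1 - ⌊s⌋₊, by omega⟩, s - ⌊s⌋₊, sub_nonneg.2 (Nat.floor_le hs.1), ?_, ?_⟩
    · linarith [Nat.lt_floor_add_one s]
    · have : ((T - 1 - ⌊s⌋₊ : ℕ) : ℝ) = T - 1 - ⌊s⌋₊ := by
        rw [Nat.cast_sub (by omega), Nat.cast_sub (by omega), Nat.cast_one]
      simp only [this]
      ring
  · exact ⟨⟨0, hT⟩, 1, zero_le_one, le_rfl, by simp [h]⟩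

lemma snakePoint_fst_mem_snake {T : ℕ} (hT : 0 < T) (a : Equiv.Perm (Fin T)) {s : ℝ}
    (hs : s ∈ Icc (0 : ℝ) T) : ((snakePoint a s).1, s) ∈ snake a := by
  obtain ⟨k, u, h0, h1, rfl⟩ := exists_eq_add_of_mem_Icc hT hs
  exact (mem_snake_iff a _).2 ⟨k, u, h0, h1, Prod.ext rfl (snakePoint_add_snd a k h0 h1)⟩

lemma snakePoint_zero {T : ℕ} (a : Equiv.Perm (Fin T)) : snakePoint a 0 = 0 := by
  refine Finset.sum_eq_zero fun i _ => ?_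
  have : (i.val : ℝ) + 1 ≤ T := by exact_mod_cast i.isLt
  rw [clamp_of_nonpos (by linarith), zero_smul]

lemma snakePoint_top {T : ℕ} (a : Equiv.Perm (Fin T)) :
    snakePoint a T = ∑ i : Fin T, xi i := by
  rw [← Equiv.sum_comp a]
  refine Finset.sum_congr rfl fun i _ => ?_
  rw [clamp_of_one_le (by linarith [(Nat.cast_nonneg i.val : (0 : ℝ) ≤ i.val)]), one_smul]

/-- The weak order on permutations orders the snakes horizontally. -/
lemma snakePoint_fst_le {T : ℕ} (a b : Equiv.Perm (Fin T))
    (h : ∀ i j, i < j → b.symm i < b.symm j → a.symm i < a.symm j) (k : Fin T) {u : ℝ}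
    (h0 : 0 ≤ u) (h1 : u ≤ 1) :
    (snakePoint b (T - 1 - k.val + u)).1 ≤ (snakePoint a (T - 1 - k.val + u)).1 := by
  simp only [snakePoint_add _ k h0 h1, Prod.fst_add, Prod.smul_fst, smul_eq_mul]
  have := sub_nonneg.2 h1
  gcongr <;> exact snakeVertex_fst_le a b h _

/-! ### The region between two graphs -/

/-- Points between two graphs over `[c, d]` (drawn over the second coordinate) with common ends
belong to the region bounded by them: the open region strictly between the graphs is relatively
clopen in the complement of the graphs, and bounded. -/
lemma mem_regionBoundedBy_of_between {A B : Set (ℝ × ℝ)} {f g : ℝ → ℝ} (hf : Continuous f)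
    (hg : Continuous g) {c d : ℝ} (hc : f c = g c) (hd : f d = g d)
    (hfAB : ∀ s ∈ Icc c d, (f s, s) ∈ A ∪ B) (hgAB : ∀ s ∈ Icc c d, (g s, s) ∈ A ∪ B)
    {z : ℝ × ℝ} (hz : z.2 ∈ Icc c d) (hfz : f z.2 ≤ z.1) (hzg : z.1 ≤ g z.2) :
    z ∈ regionBoundedBy A B := by
  by_cases hzAB : z ∈ A ∪ B
  · exact Or.inl hzAB
  refine Or.inr ⟨hzAB, ?_⟩
  let D : Set (ℝ × ℝ) := {w | c < w.2 ∧ w.2 < d ∧ f w.2 < w.1 ∧ w.1 < g w.2}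
  let E : Set (ℝ × ℝ) := {w | c ≤ w.2 ∧ w.2 ≤ d ∧ f w.2 ≤ w.1 ∧ w.1 ≤ g w.2}
  have hDE : D ⊆ E := fun w hw => ⟨hw.1.le, hw.2.1.le, hw.2.2.1.le, hw.2.2.2.le⟩
  have hED : ∀ w ∈ E, w ∉ A ∪ B → w ∈ D := by
    rintro ⟨x, s⟩ ⟨h1, h2, h3, h4⟩ hw
    dsimp only at h1 h2 h3 h4
    have hxf : x ≠ f s := by
      rintro rfl
      exact hw (hfAB s ⟨h1, h2⟩)
    have hxg : x ≠ g s := by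
      rintro rfl
      exact hw (hgAB s ⟨h1, h2⟩)
    refine ⟨h1.lt_of_ne ?_, h2.lt_of_ne ?_, h3.lt_of_ne hxf.symm, h4.lt_of_ne hxg⟩
    · rintro rfl
      exact hxf (le_antisymm (h4.trans_eq hc.symm) h3)
    · rintro rfl
      exact hxf (le_antisymm (h4.trans_eq hd.symm) h3)
  have hfw : Continuous fun w : ℝ × ℝ => f w.2 := hf.comp continuous_snd
  have hgw : Continuous fun w : ℝ × ℝ => g w.2 := hg.comp continuous_snd
  have hDo : IsOpen D := by
    simp only [D, ofPred_and]
    exact (isOpen_lt continuous_const continuous_snd).inter <|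
      (isOpen_lt continuous_snd continuous_const).inter <|
        (isOpen_lt hfw continuous_fst).inter (isOpen_lt continuous_fst hgw)
  have hEc : IsClosed E := by
    simp only [E, ofPred_and]
    exact (isClosed_le continuous_const continuous_snd).inter <|
      (isClosed_le continuous_snd continuous_const).inter <|
        (isClosed_le hfw continuous_fst).inter (isClosed_le continuous_fst hgw)
  have hsub : connectedComponentIn (A ∪ B)ᶜ z ⊆ D := by
    refine isPreconnected_connectedComponentIn.subset_left_of_subset_union hDo hEc.isOpen_compl
      (disjoint_compl_right.mono_left hDE) (fun w hw => ?_)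
      ⟨z, mem_connectedComponentIn hzAB, hED z ⟨hz.1, hz.2, hfz, hzg⟩ hzAB⟩
    by_cases hwE : w ∈ E
    · exact Or.inl (hED w hwE (connectedComponentIn_subset _ _ hw))
    · exact Or.inr hwE
  obtain ⟨m, hm⟩ := (isCompact_Icc.image (s := Icc c d) hf).bddBelow
  obtain ⟨M, hM⟩ := (isCompact_Icc.image (s := Icc c d) hg).bddAbove
  refine ((Metric.isBounded_Icc m M).prod (Metric.isBounded_Icc c d)).subset
    (hsub.trans fun w hw => ?_)
  obtain ⟨h1, h2, h3, h4⟩ := hDE hw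
  exact ⟨⟨(hm ⟨w.2, ⟨h1, h2⟩, rfl⟩).trans h3, h4.trans (hM ⟨w.2, ⟨h1, h2⟩, rfl⟩)⟩, h1, h2⟩

lemma snake_subset_regionBoundedBy {T : ℕ} (a b c : Equiv.Perm (Fin T))
    (hab : ∀ i j, i < j → b.symm i < b.symm j → a.symm i < a.symm j)
    (hbc : ∀ i j, i < j → c.symm i < c.symm j → b.symm i < b.symm j) :
    snake b ⊆ regionBoundedBy (snake a) (snake c) := by
  intro z hz
  obtain ⟨k, u, h0, h1, rfl⟩ := (mem_snake_iff b z).1 hz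
  have hT : 0 < T := k.pos
  have hk : (k.val : ℝ) + 1 ≤ T := by exact_mod_cast k.isLt
  have hk0 : (0 : ℝ) ≤ k.val := Nat.cast_nonneg _
  refine mem_regionBoundedBy_of_between (f := fun s => (snakePoint c s).1)
    (g := fun s => (snakePoint a s).1) (c := 0) (d := T) (continuous_snakePoint c).fst
    (continuous_snakePoint a).fst (by simp only [snakePoint_zero])
    (by simp only [snakePoint_top]) (fun s hs => Or.inr (snakePoint_fst_mem_snake hT c hs))
    (fun s hs => Or.inl (snakePoint_fst_mem_snake hT a hs)) ?_ ?_ ?_ <;>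
    rw [snakePoint_add_snd b k h0 h1]
  · exact ⟨by linarith, by linarith⟩
  · exact snakePoint_fst_le b c hbc k h0 h1
  · exact snakePoint_fst_le a b hab k h0 h1

end Elasticity

theorem mainTheorem4 {T : ℕ}
    (y p₀ : Fin T → ℝ) (p : Fin T → ℝ × ℝ)
    (hy : ∀ t, 0 ≤ y t) (hp₀ : ∀ t, 0 < p₀ t) (hp : ∀ t, 0 < (p t).1 ∧ 0 < (p t).2)
    (ρ : ℝ) (hρ : ρ ∈ Set.Ico (-1 : ℝ) 0 ∪ Set.Ioi 0)
    (ε : ℝ) (hε : Elasticity.AdmissibleEps p₀ p ρ ε)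
    -- the time moments are numbered in increasing order of the first transformed price
    (h₁ : StrictMono fun t => (Elasticity.ptilde p₀ p ρ ε t).1)
    -- `sigma` is the permutation `Σ_ρ` ordering the second transformed prices
    (sigma : Equiv.Perm (Fin T))
    (h₂ : StrictMono fun k => (Elasticity.ptilde p₀ p ρ ε (sigma k)).2)
    -- `lam` is the permutation `λ` with `y(λ(T)) < ⋯ < y(λ(1))`
    (lam : Equiv.Perm (Fin T))
    (hlam : StrictAnti fun k => y (lam k))
    (hsnake : ¬ Elasticity.snake lam ⊆
      Elasticity.regionBoundedBy (Elasticity.snake (1 : Equiv.Perm (Fin T)))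
        (Elasticity.snake sigma)) :
    ¬ Elasticity.IsElasticitySolution y p₀ p ρ := by
  rintro ⟨-, hsol⟩
  have hρ0 : ρ ≠ 0 := by
    rcases hρ with h | h
    · exact h.2.ne
    · exact (Set.mem_Ioi.1 h).ne'
  refine hsnake (Elasticity.snake_subset_regionBoundedBy 1 lam sigma (fun i j hij _ => hij)
    fun i j hij hs => ?_)
  have h2 := h₂ hs
  simp only [Equiv.apply_symm_apply] at h2
  obtain ⟨e1, e2⟩ := Elasticity.phat_le_of_ptilde_le hρ0 hp₀ hp (h₁ hij).le h2.le
  have hyij := Elasticity.le_of_phat_le hρ0 hp₀ hp hsol e1 e2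
  -- `λ` lists the times by decreasing `y`, so `y j ≤ y i` puts `i` before `j`
  have hle : lam.symm i ≤ lam.symm j := by
    refine hlam.le_iff_ge.1 ?_
    simpa only [Equiv.apply_symm_apply] using hyij
  exact hle.lt_of_ne fun h => hij.ne (lam.symm.injective h)
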